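/- All graphs are finite and simple. The strong product $G\boxtimes H$ of graphs $G$ and $H$ has vertex set $V(G)\times V(H)$, and $(x_1,y_1)$, $(x_2,y_2)$ are adjacent in it if $x_1=x_2$ and $y_1y_2\in E(H)$, or $x_1x_2\in E(G)$ and $y_1=y_2$, or $x_1x_2\in E(G)$ and $y_1y_2\in E(H)$. An orientation of a graph $F$ is a digraph obtained from $F$ by giving each edge exactly one of its two directions; it is strong if for all vertices $u,v$ it contains a directed path from $u$ to $v$. The diameter of a strong digraph is the maximum, over all ordered pairs $(u,v)$ of vertices, of the length of a shortest directed path from $u$ to $v$. Let $\mathrm{diam}_{\min}(F)$ be the minimum diameter of a strong orientation of $F$ (with $\mathrm{diam}_{\min}(F)=\infty$ if $F$ has none), and let $\mathrm{rad}(F)$ be the radius of $F$, i.e. the minimum over vertices $x$ of $\max_{v}\mathrm{dist}_F(x,v)$. **Corollary.** For any connected graphs $G$ and $H$, each with at least two vertices, $$\mathrm{diam}_{\min}(G\boxtimes H)\le 2\,\mathrm{rad}(G\boxtimes H)+15 .$$ In particular, $G\boxtimes H$ has a strong orientation. -/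

import Mathlib

/-- The strong product of two simple graphs: `(x₁, y₁)` and `(x₂, y₂)` are adjacent if
`x₁ = x₂` and `y₁ y₂` is an edge, or `x₁ x₂` is an edge and `y₁ = y₂`, or both
`x₁ x₂` and `y₁ y₂` are edges. -/
def SimpleGraph.strongProd {V W : Type*} (G : SimpleGraph V) (H : SimpleGraph W) :
    SimpleGraph (V × W) where
  Adj p q := (p.1 = q.1 ∧ H.Adj p.2 q.2) ∨ (G.Adj p.1 q.1 ∧ p.2 = q.2) ∨
    (G.Adj p.1 q.1 ∧ H.Adj p.2 q.2)
  symm := ⟨fun p q h => by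
    rcases h with h | h | h
    · exact Or.inl ⟨h.1.symm, h.2.symm⟩
    · exact Or.inr (Or.inl ⟨h.1.symm, h.2.symm⟩)
    · exact Or.inr (Or.inr ⟨h.1.symm, h.2.symm⟩)⟩
  loopless := ⟨fun p h => by
    rcases h with h | h | h
    · exact h.2.ne rfl
    · exact h.1.ne rfl
    · exact h.1.ne rfl⟩

namespace Digraph

/-- There is a directed `uv`-path with exactly `n` arcs in `D`: a sequence of pairwise distinct
vertices `u = p 0, p 1, …, p n = v` with an arc from each one to the next. -/
def HasPath {V : Type*} (D : Digraph V) (n : ℕ) (u v : V) : Prop :=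
  ∃ p : ℕ → V, p 0 = u ∧ p n = v ∧ Set.InjOn p (Set.Iic n) ∧ ∀ i < n, D.Adj (p i) (p (i + 1))

/-- A digraph is strong if every vertex can be reached from every vertex by a directed path. -/
def IsStrong {V : Type*} (D : Digraph V) : Prop :=
  ∀ u v : V, ∃ n : ℕ, D.HasPath n u v

/-- The directed distance from `u` to `v`: the least length of a directed `uv`-path,
and `⊤` if there is none. -/
noncomputable def edist {V : Type*} (D : Digraph V) (u v : V) : ℕ∞ :=
  ⨅ (n : ℕ) (_ : D.HasPath n u v), (n : ℕ∞)

/-- The diameter of a digraph: the largest directed distance between two of its vertices. -/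
noncomputable def ediam {V : Type*} (D : Digraph V) : ℕ∞ :=
  ⨆ (u : V) (v : V), D.edist u v

/-- `D` is an orientation of `G`: the arcs of `D` are the edges of `G`, each of them
directed in exactly one of its two directions. -/
def IsOrientationOf {V : Type*} (D : Digraph V) (G : SimpleGraph V) : Prop :=
  (∀ u v : V, G.Adj u v ↔ D.Adj u v ∨ D.Adj v u) ∧ ∀ u v : V, D.Adj u v → ¬ D.Adj v u

end Digraph

/-- The least diameter of a strong orientation of `G` (`⊤` if `G` has no strong orientation). -/
noncomputable def SimpleGraph.diamMin {V : Type*} (G : SimpleGraph V) : ℕ∞ :=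
  sInf {d : ℕ∞ | ∃ D : Digraph V, D.IsOrientationOf G ∧ D.IsStrong ∧ D.ediam = d}

/-- If `diamMin G` is finite, then it is attained by a strong orientation of `G`. -/
theorem SimpleGraph.exists_orientation_of_diamMin_ne_top {V : Type*} (G : SimpleGraph V)
    (h : G.diamMin ≠ ⊤) :
    ∃ D : Digraph V, D.IsOrientationOf G ∧ D.IsStrong ∧ D.ediam = G.diamMin := by
  have hne : {d : ℕ∞ | ∃ D : Digraph V, D.IsOrientationOf G ∧ D.IsStrong ∧ D.ediam = d}.Nonempty := by
    by_contra hn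
    rw [Set.not_nonempty_iff_eq_empty] at hn
    exact h (by rw [SimpleGraph.diamMin, hn, sInf_empty])
  exact csInf_mem hne

/-! Fix a central vertex (x, y) of the product and grade vertices by depths i = dist(x, u), j =
dist(y, v). Diagonal edges can keep the parity of i + j while changing max(i, j) by one, so the two
parity classes act as two one-way networks: even vertices descend to the root, odd ones ascend from
it. At depth 0 in one coordinate, that coordinate steps between 0 and 1 instead. Edges joining the
classes mostly run from odd to even; arcs from the root to (0, 1) open the odd network. Reaching the
root costs at most r + 1 and leaving it r + 2, so the diameter is at most 2r + 3, well within 2r +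
15. -/

namespace Digraph

/-- There is a directed walk with exactly `n` arcs from one vertex to another. -/
def HasWalk {V : Type*} (D : Digraph V) : ℕ → V → V → Prop
  | 0, u, v => u = v
  | n + 1, u, v => ∃ w, D.Adj u w ∧ D.HasWalk n w v

theorem HasWalk.append {V : Type*} {D : Digraph V} {m n : ℕ} {u v w : V}
    (h : D.HasWalk m u v) (h' : D.HasWalk n v w) : D.HasWalk (m + n) u w := by
  induction m generalizing u with
  | zero => obtain rfl : u = v := h; simpa using h'
  | succ m ih =>
    obtain ⟨x, hx, hw⟩ := h
    rw [Nat.add_right_comm]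
    exact ⟨x, hx, ih hw⟩

theorem HasWalk.concat {V : Type*} {D : Digraph V} {n : ℕ} {u v w : V}
    (h : D.HasWalk n u v) (h' : D.Adj v w) : D.HasWalk (n + 1) u w :=
  h.append ⟨w, h', rfl⟩

theorem HasPath.tail {V : Type*} {D : Digraph V} {n k : ℕ} {u v : V} {p : ℕ → V}
    (hk : k ≤ n) (hn : p n = v) (hinj : Set.InjOn p (Set.Iic n))
    (hadj : ∀ i < n, D.Adj (p i) (p (i + 1))) (hu : p k = u) : D.HasPath (n - k) u v := by
  refine ⟨fun i => p (k + i), by simpa using hu, by simp [Nat.add_sub_cancel' hk, hn], ?_, ?_⟩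
  · intro i hi j hj hij
    simp only [Set.mem_Iic] at hi hj
    have := hinj (Set.mem_Iic.2 (by omega : k + i ≤ n)) (Set.mem_Iic.2 (by omega : k + j ≤ n)) hij
    omega
  · intro i hi
    exact hadj (k + i) (by omega)

/-- A directed walk contains a directed path between its ends. -/
theorem HasWalk.exists_hasPath {V : Type*} {D : Digraph V} {n : ℕ} {u v : V}
    (h : D.HasWalk n u v) : ∃ m ≤ n, D.HasPath m u v := by
  induction n generalizing u with
  | zero =>
    obtain rfl : u = v := h
    exact ⟨0, le_rfl, fun _ => u, rfl, rfl, by intro i hi j hj _; simp_all, by simp⟩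
  | succ n ih =>
    obtain ⟨w, hw, hwv⟩ := h
    obtain ⟨m, hm, p, hp0, hpm, hinj, hadj⟩ := ih hwv
    -- If the path already visits `u`, its tail from there suffices.
    by_cases hu : ∃ k ≤ m, p k = u
    · obtain ⟨k, hk, hpk⟩ := hu
      exact ⟨m - k, by omega, HasPath.tail hk hpm hinj hadj hpk⟩
    · push Not at hu
      refine ⟨m + 1, by omega, fun i => Nat.casesOn i u p, rfl, hpm, ?_, ?_⟩
      · rintro (_ | i) hi (_ | j) hj hij
        · rfl
        · exact absurd hij.symm (hu j (by simpa using hj))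
        · exact absurd hij (hu i (by simpa using hi))
        · exact congrArg (· + 1) (hinj (by simpa using hi) (by simpa using hj) hij)
      · rintro (_ | i) hi
        · simpa [hp0] using hw
        · exact hadj i (by omega)

theorem HasWalk.edist_le {V : Type*} {D : Digraph V} {n : ℕ} {u v : V}
    (h : D.HasWalk n u v) : D.edist u v ≤ n := by
  obtain ⟨m, hm, hp⟩ := h.exists_hasPath
  exact (iInf₂_le m hp).trans (by exact_mod_cast hm)

end Digraph

/-! ### Partial orientations and distances in strong products -/

namespace SimpleGraph

/-- Every antisymmetric choice of directions for some of the edges of a graph extends to an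
orientation. -/
theorem exists_isOrientationOf_extending {V : Type*} (G : SimpleGraph V) (R : V → V → Prop)
    (hR : ∀ u v, R u v → ¬ R v u) :
    ∃ D : Digraph V, D.IsOrientationOf G ∧ ∀ u v, G.Adj u v → R u v → D.Adj u v := by
  -- A well-order of the vertices decides the edges on which `R` is silent.
  refine ⟨⟨fun u v => G.Adj u v ∧ (R u v ∨ (¬ R v u ∧ WellOrderingRel u v))⟩, ⟨?_, ?_⟩, ?_⟩
  · intro u v
    constructor
    · intro h
      rcases trichotomous_of (WellOrderingRel (α := V)) u v with h' | h' | h'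
      · by_cases h1 : R v u
        · exact Or.inr ⟨h.symm, Or.inl h1⟩
        · exact Or.inl ⟨h, Or.inr ⟨h1, h'⟩⟩
      · exact absurd h' h.ne
      · by_cases h1 : R u v
        · exact Or.inl ⟨h, Or.inl h1⟩
        · exact Or.inr ⟨h.symm, Or.inr ⟨h1, h'⟩⟩
    · rintro (h | h)
      exacts [h.1, h.1.symm]
  · rintro u v ⟨-, h⟩ ⟨-, h'⟩
    rcases h with h | h <;> rcases h' with h' | h'
    · exact hR _ _ h h'
    · exact h'.1 h
    · exact h.1 h'
    · exact asymm_of (WellOrderingRel (α := V)) h.2 h'.2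
  · exact fun u v h h' => ⟨h, Or.inl h'⟩

theorem Connected.exists_adj_dist_succ {V : Type*} {G : SimpleGraph V} (hG : G.Connected)
    (x : V) {u : V} (hu : G.dist x u ≠ 0) :
    ∃ w, G.Adj u w ∧ G.dist x u = G.dist x w + 1 := by
  obtain ⟨p, hp⟩ := hG.exists_walk_length_eq_dist u x
  rw [dist_comm] at hp
  cases p with
  | nil => simp at hu
  | @cons _ w _ h q =>
    refine ⟨w, h, ?_⟩
    have h1 : G.dist x w ≤ q.length := by rw [dist_comm]; exact dist_le q
    have h2 : G.dist x u ≤ G.dist x w + G.dist w u := hG.dist_triangle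
    rw [dist_eq_one_iff_adj.2 h.symm] at h2
    rw [Walk.length_cons] at hp
    omega

theorem Connected.exists_adj_dist_eq_one {V : Type*} [Nontrivial V] {G : SimpleGraph V}
    (hG : G.Connected) (x : V) : ∃ w, G.Adj x w ∧ G.dist x w = 1 := by
  obtain ⟨w, hw⟩ := hG.preconnected.exists_adj_of_nontrivial x
  exact ⟨w, hw, dist_eq_one_iff_adj.2 hw⟩

/-- Each edge of the product moves either coordinate by distance at most one. -/
theorem strongProd_dist_le_length {V W : Type*} {G : SimpleGraph V} {H : SimpleGraph W}
    (hG : G.Connected) (hH : H.Connected) {a b : V × W} (p : (G.strongProd H).Walk a b) :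
    G.dist a.1 b.1 ≤ p.length ∧ H.dist a.2 b.2 ≤ p.length := by
  induction p with
  | nil => simp
  | @cons a c b h q ih =>
    have h1 : G.dist a.1 c.1 ≤ 1 := by
      rcases h with h | h | h
      · simp [h.1]
      · exact (dist_eq_one_iff_adj.2 h.1).le
      · exact (dist_eq_one_iff_adj.2 h.1).le
    have h2 : H.dist a.2 c.2 ≤ 1 := by
      rcases h with h | h | h
      · exact (dist_eq_one_iff_adj.2 h.2).le
      · simp [h.2]
      · exact (dist_eq_one_iff_adj.2 h.2).le
    have h3 : G.dist a.1 b.1 ≤ G.dist a.1 c.1 + G.dist c.1 b.1 := hG.dist_triangle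
    have h4 : H.dist a.2 b.2 ≤ H.dist a.2 c.2 + H.dist c.2 b.2 := hH.dist_triangle
    rw [Walk.length_cons]
    omega

theorem strongProd_dist_le_of_edist_le {V W : Type*} {G : SimpleGraph V} {H : SimpleGraph W}
    (hG : G.Connected) (hH : H.Connected) {a b : V × W} {r : ℕ}
    (h : (G.strongProd H).edist a b ≤ r) : G.dist a.1 b.1 ≤ r ∧ H.dist a.2 b.2 ≤ r := by
  obtain ⟨p, hp⟩ := exists_walk_of_edist_ne_top (ne_top_of_le_ne_top (ENat.natCast_ne_top r) h)
  rw [← hp, Nat.cast_le] at h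
  have := strongProd_dist_le_length hG hH p
  omega

/-- The rule directing an edge of a strong product from a vertex whose coordinates are at
distances `i`, `j` from a fixed root to a vertex whose coordinates are at distances `i'`, `j'`.
Vertices with `i + j` even are used to travel towards the root, the others to travel away
from it. -/
inductive DepthArc (i j i' j' : ℕ) : Prop
  | descend (hi : i = i' + 1) (hj : j = j' + 1) (he : (i + j) % 2 = 0)
  | ascend (hi : i' = i + 1) (hj : j' = j + 1) (ho : (i + j) % 2 = 1)
  | toEven (ho : (i + j) % 2 = 1) (he : (i' + j') % 2 = 0) (hne : 0 < i' ∨ j ≠ 1 ∨ 0 < i ∨ 0 < j')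
  | leaveRoot (hi : i = 0) (hj : j = 0) (hi' : i' = 0) (hj' : j' = 1)
  | descendLeftAxis (hi : i = 0) (hi' : i' = 1) (hj : j = j' + 1) (he : j % 2 = 0)
  | descendRightAxis (hj : j = 0) (hj' : j' = 1) (hi : i = i' + 1) (he : i % 2 = 0)
  | ascendLeftAxis (hi : i = 1) (hi' : i' = 0) (hj : j' = j + 1) (ho : j' % 2 = 1) (h2 : 2 ≤ j')
  | ascendRightAxis (hj : j = 1) (hj' : j' = 0) (hi : i' = i + 1) (ho : i' % 2 = 1) (h2 : 2 ≤ i')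
  | turn (hi : i = 0) (hj : j = 1) (hi' : i' = 1) (hj' : j' = 0)

/-- Parity separates descending from ascending arcs. The remaining clashes are removed by side
conditions: `hne` exempts (0, 1) → (0, 0), the reverse of `leaveRoot`, and `h2` in `ascendLeftAxis`
exempts (1, 0) → (0, 1), the reverse of `turn`. -/
theorem DepthArc.asymm {i j i' j' : ℕ} (h : DepthArc i j i' j') : ¬ DepthArc i' j' i j := by
  intro h'
  cases h <;> cases h' <;> omega

/-! ### Walks to and from the root -/

section DepthOrientation

variable {V W : Type*} {G : SimpleGraph V} {H : SimpleGraph W} {x : V} {y : W}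
  {D : Digraph (V × W)}

/-- The digraph `D` directs the edges of `G.strongProd H` by the rule `DepthArc` with
respect to the root `(x, y)`, wherever that rule applies. -/
def FollowsDepth (G : SimpleGraph V) (H : SimpleGraph W) (x : V) (y : W)
    (D : Digraph (V × W)) : Prop :=
  ∀ a b, (G.strongProd H).Adj a b →
    DepthArc (G.dist x a.1) (H.dist y a.2) (G.dist x b.1) (H.dist y b.2) → D.Adj a b

theorem FollowsDepth.adj_both (hD : FollowsDepth G H x y D) {u u' : V} {v v' : W}
    (hu : G.Adj u u') (hv : H.Adj v v')
    (h : DepthArc (G.dist x u) (H.dist y v) (G.dist x u') (H.dist y v')) :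
    D.Adj (u, v) (u', v') :=
  hD _ _ (Or.inr (Or.inr ⟨hu, hv⟩)) h

theorem FollowsDepth.adj_left (hD : FollowsDepth G H x y D) {u u' : V} {v : W}
    (hu : G.Adj u u')
    (h : DepthArc (G.dist x u) (H.dist y v) (G.dist x u') (H.dist y v)) :
    D.Adj (u, v) (u', v) :=
  hD _ _ (Or.inr (Or.inl ⟨hu, rfl⟩)) h

theorem FollowsDepth.adj_right (hD : FollowsDepth G H x y D) {u : V} {v v' : W}
    (hv : H.Adj v v')
    (h : DepthArc (G.dist x u) (H.dist y v) (G.dist x u) (H.dist y v')) :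
    D.Adj (u, v) (u, v') :=
  hD _ _ (Or.inl ⟨rfl, hv⟩) h

variable [Nontrivial V] [Nontrivial W]

/-- From a vertex of even total depth, the root is reached as fast as in the undirected graph. -/
theorem FollowsDepth.hasWalk_to_root_of_even (hD : FollowsDepth G H x y D) (hG : G.Connected)
    (hH : H.Connected) (n : ℕ) (u : V) (v : W) (hn : max (G.dist x u) (H.dist y v) = n)
    (he : (G.dist x u + H.dist y v) % 2 = 0) : D.HasWalk n (u, v) (x, y) := by
  induction n generalizing u v with
  | zero =>
    have hu : x = u := hG.dist_eq_zero_iff.1 (by omega)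
    have hv : y = v := hH.dist_eq_zero_iff.1 (by omega)
    rw [hu, hv]
    rfl
  | succ n ih =>
    by_cases hu : G.dist x u = 0
    · obtain rfl := hG.dist_eq_zero_iff.1 hu
      obtain ⟨c, hc, hc1⟩ := hG.exists_adj_dist_eq_one x
      obtain ⟨v', hv, hv1⟩ := hH.exists_adj_dist_succ y (u := v) (by omega)
      exact ⟨(c, v'), hD.adj_both hc hv (by apply DepthArc.descendLeftAxis <;> omega),
        ih c v' (by omega) (by omega)⟩
    · obtain ⟨u', hu', hu1⟩ := hG.exists_adj_dist_succ x hu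
      by_cases hv : H.dist y v = 0
      · obtain rfl := hH.dist_eq_zero_iff.1 hv
        obtain ⟨c, hc, hc1⟩ := hH.exists_adj_dist_eq_one y
        exact ⟨(u', c), hD.adj_both hu' hc (by apply DepthArc.descendRightAxis <;> omega),
          ih u' c (by omega) (by omega)⟩
      · obtain ⟨v', hv', hv1⟩ := hH.exists_adj_dist_succ y hv
        exact ⟨(u', v'), hD.adj_both hu' hv' (by apply DepthArc.descend <;> omega),
          ih u' v' (by omega) (by omega)⟩

/-- An odd vertex first spends one arc on entering the even class, without increasing the larger
depth. -/
theorem FollowsDepth.exists_hasWalk_to_root (hD : FollowsDepth G H x y D) (hG : G.Connected)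
    (hH : H.Connected) (u : V) (v : W) :
    ∃ n ≤ max (G.dist x u) (H.dist y v) + 1, D.HasWalk n (u, v) (x, y) := by
  by_cases he : (G.dist x u + H.dist y v) % 2 = 0
  · exact ⟨_, by omega, hD.hasWalk_to_root_of_even hG hH _ u v rfl he⟩
  · by_cases hu : G.dist x u = 0
    · obtain rfl := hG.dist_eq_zero_iff.1 hu
      obtain ⟨c, hc, hc1⟩ := hG.exists_adj_dist_eq_one x
      exact ⟨max (G.dist x c) (H.dist y v) + 1, by omega, (c, v),
        hD.adj_left hc (by apply DepthArc.toEven <;> omega),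
        hD.hasWalk_to_root_of_even hG hH _ c v rfl (by omega)⟩
    · obtain ⟨u', hu', hu1⟩ := hG.exists_adj_dist_succ x hu
      exact ⟨max (G.dist x u') (H.dist y v) + 1, by omega, (u', v),
        hD.adj_left hu' (by apply DepthArc.toEven <;> omega),
        hD.hasWalk_to_root_of_even hG hH _ u' v rfl (by omega)⟩

/-- The extra arc comes from depths (1, 0), reached only by the detour through (0, 1), since the
edge to the root points inwards. -/
theorem FollowsDepth.exists_hasWalk_from_root_of_odd (hD : FollowsDepth G H x y D)
    (hG : G.Connected) (hH : H.Connected) (n : ℕ) (u : V) (v : W)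
    (hn : max (G.dist x u) (H.dist y v) = n) (ho : (G.dist x u + H.dist y v) % 2 = 1) :
    ∃ m ≤ n + 1, D.HasWalk m (x, y) (u, v) := by
  induction n generalizing u v with
  | zero => omega
  | succ n ih =>
    have hx : G.dist x x = 0 := dist_self
    have hy : H.dist y y = 0 := dist_self
    have step (u' : V) (v' : W) (h : D.Adj (u', v') (u, v))
        (hmax : max (G.dist x u') (H.dist y v') = n)
        (hodd : (G.dist x u' + H.dist y v') % 2 = 1) :
        ∃ m ≤ n + 1 + 1, D.HasWalk m (x, y) (u, v) := by
      obtain ⟨m, hm, hw⟩ := ih u' v' hmax hodd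
      exact ⟨m + 1, by omega, hw.concat h⟩
    by_cases hu : G.dist x u = 0
    · obtain rfl := hG.dist_eq_zero_iff.1 hu
      obtain ⟨v', hv', hv1⟩ := hH.exists_adj_dist_succ y (u := v) (by omega)
      by_cases hv0 : H.dist y v' = 0
      · obtain rfl := hH.dist_eq_zero_iff.1 hv0
        exact ⟨1, by omega, (x, v), hD.adj_right hv'.symm
          (by apply DepthArc.leaveRoot <;> omega), rfl⟩
      · obtain ⟨c, hc, hc1⟩ := hG.exists_adj_dist_eq_one x
        exact step c v' (hD.adj_both hc.symm hv'.symm (by apply DepthArc.ascendLeftAxis <;> omega))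
          (by omega) (by omega)
    · obtain ⟨u', hu', hu1⟩ := hG.exists_adj_dist_succ x hu
      by_cases hv : H.dist y v = 0
      · obtain rfl := hH.dist_eq_zero_iff.1 hv
        obtain ⟨c, hc, hc1⟩ := hH.exists_adj_dist_eq_one y
        by_cases hu0 : G.dist x u' = 0
        · obtain rfl := hG.dist_eq_zero_iff.1 hu0
          exact ⟨2, by omega, (x, c), hD.adj_right hc
            (by apply DepthArc.leaveRoot <;> omega), (u, y),
            hD.adj_both hu'.symm hc.symm (by apply DepthArc.turn <;> omega), rfl⟩
        · exact step u' c (hD.adj_both hu'.symm hc.symm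
            (by apply DepthArc.ascendRightAxis <;> omega))
            (by omega) (by omega)
      · obtain ⟨v', hv', hv1⟩ := hH.exists_adj_dist_succ y hv
        exact step u' v' (hD.adj_both hu'.symm hv'.symm (by apply DepthArc.ascend <;> omega))
          (by omega) (by omega)

/-- An even vertex other than the root is entered from an odd neighbour one step shallower in one
coordinate. -/
theorem FollowsDepth.exists_hasWalk_from_root (hD : FollowsDepth G H x y D) (hG : G.Connected)
    (hH : H.Connected) (u : V) (v : W) :
    ∃ n ≤ max (G.dist x u) (H.dist y v) + 2, D.HasWalk n (x, y) (u, v) := by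
  have hx : G.dist x x = 0 := dist_self
  by_cases he : (G.dist x u + H.dist y v) % 2 = 1
  · obtain ⟨m, hm, hw⟩ := hD.exists_hasWalk_from_root_of_odd hG hH _ u v rfl he
    exact ⟨m, by omega, hw⟩
  · by_cases hu : G.dist x u = 0
    · obtain rfl := hG.dist_eq_zero_iff.1 hu
      by_cases hv : H.dist y v = 0
      · obtain rfl := hH.dist_eq_zero_iff.1 hv
        exact ⟨0, by omega, rfl⟩
      · obtain ⟨v', hv', hv1⟩ := hH.exists_adj_dist_succ y hv
        obtain ⟨m, hm, hw⟩ :=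
          hD.exists_hasWalk_from_root_of_odd hG hH _ x v' rfl (by omega)
        exact ⟨m + 1, by omega, hw.concat (hD.adj_right hv'.symm
          (by apply DepthArc.toEven <;> omega))⟩
    · obtain ⟨u', hu', hu1⟩ := hG.exists_adj_dist_succ x hu
      obtain ⟨m, hm, hw⟩ :=
        hD.exists_hasWalk_from_root_of_odd hG hH _ u' v rfl (by omega)
      exact ⟨m + 1, by omega, hw.concat (hD.adj_left hu'.symm (by apply DepthArc.toEven <;> omega))⟩

end DepthOrientation

/-- If all vertices of `G` are within distance `r` of `x`, and all vertices of `H` within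
distance `r` of `y`, then the strong product has a strong orientation of diameter at most
`2 * r + 3`. -/
theorem diamMin_strongProd_le_of_dist_le {V W : Type*} [Nontrivial V] [Nontrivial W]
    {G : SimpleGraph V} {H : SimpleGraph W} (hG : G.Connected) (hH : H.Connected) {x : V} {y : W}
    {r : ℕ} (hx : ∀ u, G.dist x u ≤ r) (hy : ∀ v, H.dist y v ≤ r) :
    (G.strongProd H).diamMin ≤ 2 * r + 3 := by
  obtain ⟨D, hor, hfol⟩ := (G.strongProd H).exists_isOrientationOf_extending
    (fun a b => DepthArc (G.dist x a.1) (H.dist y a.2) (G.dist x b.1) (H.dist y b.2))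
    (fun _ _ h => h.asymm)
  have hD : FollowsDepth G H x y D := hfol
  have hwalk (a b : V × W) : ∃ n ≤ 2 * r + 3, D.HasWalk n a b := by
    obtain ⟨m, hm, hm'⟩ := hD.exists_hasWalk_to_root hG hH a.1 a.2
    obtain ⟨n, hn, hn'⟩ := hD.exists_hasWalk_from_root hG hH b.1 b.2
    have := hx a.1
    have := hy a.2
    have := hx b.1
    have := hy b.2
    exact ⟨m + n, by omega, hm'.append hn'⟩
  have hstrong : D.IsStrong := fun a b => by
    obtain ⟨n, -, hn⟩ := hwalk a b
    obtain ⟨m, -, hm⟩ := hn.exists_hasPath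
    exact ⟨m, hm⟩
  refine (sInf_le ⟨D, hor, hstrong, rfl⟩ : (G.strongProd H).diamMin ≤ D.ediam).trans ?_
  refine iSup₂_le fun a b => ?_
  obtain ⟨n, hn, hw⟩ := hwalk a b
  exact hw.edist_le.trans (by exact_mod_cast hn)

end SimpleGraph

theorem mainTheorem2 {V W : Type*} [Finite V] [Finite W] [Nontrivial V] [Nontrivial W]
    (G : SimpleGraph V) (H : SimpleGraph W) (hG : G.Connected) (hH : H.Connected) :
    (G.strongProd H).diamMin ≤ 2 * (G.strongProd H).radius + 15 := by
  obtain ⟨a, ha⟩ := (G.strongProd H).exists_eccent_eq_radius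
  by_cases htop : (G.strongProd H).radius = ⊤
  · simp [htop]
  · obtain ⟨r, hr⟩ := ENat.ne_top_iff_exists.1 htop
    have hdist (b : V × W) : (G.strongProd H).edist a b ≤ r := by
      rw [hr, ← ha]
      exact SimpleGraph.edist_le_eccent
    have hx (u : V) : G.dist a.1 u ≤ r :=
      (SimpleGraph.strongProd_dist_le_of_edist_le hG hH (hdist (u, a.2))).1
    have hy (v : W) : H.dist a.2 v ≤ r :=
      (SimpleGraph.strongProd_dist_le_of_edist_le hG hH (hdist (a.1, v))).2
    rw [← hr]
    refine (SimpleGraph.diamMin_strongProd_le_of_dist_le hG hH hx hy).trans ?_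
    gcongr
    norm_num
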